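/- Theorem. A function $f:(0,\infty)\to(0,\infty)$ is called matrix monotone if for every $n$ and all positive definite matrices $A,B\in M_n(\mathbb C)$ with $A\le B$ one has $f(A)\le f(B)$; it is called standard if moreover $x f(x^{-1})=f(x)$ for all $x>0$ and $f(1)=1$. For a positive definite matrix $D\in M_n(\mathbb C)$ let $\mathbb L_D X=DX$ and $\mathbb R_D X=XD$ be the left and right multiplications on $M_n(\mathbb C)$, put $$\mathbb J_D^f=f(\mathbb L_D\mathbb R_D^{-1})\,\mathbb R_D : M_n(\mathbb C)\to M_n(\mathbb C),$$ where $f(\cdot)$ is the functional calculus of the operator $\mathbb L_D\mathbb R_D^{-1}$, which is positive for the Hilbert–Schmidt inner product $\langle B,C\rangle=\mathrm{Tr}\,B^*C$, and let $$\gamma_D^f(A,B)=\mathrm{Tr}\,A\,(\mathbb J_D^f)^{-1}(B).$$ Let $f$ be a standard matrix monotone function and let $A\in M_n(\mathbb C)$ be self-adjoint. Then for every positive definite $D\in M_n(\mathbb C)$ the map $\mathbb J_D^f$ is invertible and $\gamma_D^f(A,A)$ is a real number, and $D\mapsto\gamma_D^f(A,A)$ is a convex function on the set of positive definite matrices in $M_n(\mathbb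 C)$. -/

import Mathlib

open scoped ComplexOrder

/-- `f` is matrix (operator) monotone on `(0, ∞)`: for matrices of every size, `0 < A ≤ B` implies
`f(A) ≤ f(B)`, where `f(A)` is the functional calculus of Hermitian matrices. -/
def IsMatrixMonotone (f : ℝ → ℝ) : Prop :=
  ∀ (n : ℕ) (A B : Matrix (Fin n) (Fin n) ℂ), A.PosDef → B.PosDef →
    (B - A).PosSemidef → (cfc f B - cfc f A).PosSemidef

/-- Standard matrix monotone functions `f : (0, ∞) → (0, ∞)`; the values of `f` outside `(0, ∞)`
play no role. -/
structure IsStandardMatrixMonotone (f : ℝ → ℝ) : Prop where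
  pos : ∀ x : ℝ, 0 < x → 0 < f x
  monotone : IsMatrixMonotone f
  symm : ∀ x : ℝ, 0 < x → x * f x⁻¹ = f x
  map_one : f 1 = 1

/-- The functional calculus `f(T)` of a linear map `T` on `n × n` matrices that is self-adjoint for
the Hilbert–Schmidt inner product `⟨B, C⟩ = Tr B* C`. The matrix units form an orthonormal
basis for this inner product, so that passing to the representing `n² × n²` matrix is a
`*`-isomorphism, and `f(T)` is the map represented by `f` of the matrix representing `T`. -/
noncomputable def superCfc {n : ℕ} (f : ℝ → ℝ)
    (T : Module.End ℂ (Matrix (Fin n) (Fin n) ℂ)) :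
    Module.End ℂ (Matrix (Fin n) (Fin n) ℂ) :=
  Matrix.toLin (Matrix.stdBasis ℂ (Fin n) (Fin n)) (Matrix.stdBasis ℂ (Fin n) (Fin n))
    (cfc f (LinearMap.toMatrix (Matrix.stdBasis ℂ (Fin n) (Fin n))
      (Matrix.stdBasis ℂ (Fin n) (Fin n)) T))

/-- The linear map `L_D R_D⁻¹ : X ↦ D X D⁻¹` on `n × n` matrices. -/
noncomputable def modularOp {n : ℕ} (D : Matrix (Fin n) (Fin n) ℂ) :
    Module.End ℂ (Matrix (Fin n) (Fin n) ℂ) :=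
  LinearMap.mulLeft ℂ D * LinearMap.mulRight ℂ D⁻¹

/-- `J_D^f = f(L_D R_D⁻¹) R_D`. -/
noncomputable def jOp {n : ℕ} (f : ℝ → ℝ) (D : Matrix (Fin n) (Fin n) ℂ) :
    Module.End ℂ (Matrix (Fin n) (Fin n) ℂ) :=
  superCfc f (modularOp D) * LinearMap.mulRight ℂ D

/-- `γ_D^f(A, B) = Tr A (J_D^f)⁻¹(B)`; `Ring.inverse` is the inverse linear map of an invertible
linear map. -/
noncomputable def monotoneMetric {n : ℕ} (f : ℝ → ℝ) (D A B : Matrix (Fin n) (Fin n) ℂ) : ℂ :=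
  (A * (Ring.inverse (jOp f D)) B).trace

/-!
An isometry `V` satisfies `Vᴴ f(T) V ≤ f(Vᴴ T V)` for a positive matrix monotone function `f`:
up to a factor `c > 1`, `T` is dominated by a matrix `S` that is block diagonal for the range of `V`
and whose block there is `c Vᴴ T V`, so that monotonicity gives the inequality with `f(c Vᴴ T V)` on
the right. Applied to block columns this is Jensen's operator inequality, which makes the operator
perspective `R^{1/2} f(R^{-1/2} L R^{-1/2}) R^{1/2}` jointly concave in `(L, R)`. At
`L = L_D`, `R = R_D`, which commute and are linear in `D`, the perspective is `J_D^f`; hence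
`D ↦ J_D^f` is concave. Since inversion is antitone and operator convex, `D ↦ ⟨A, (J_D^f)⁻¹ A⟩` is
convex.
-/

open Matrix
open scoped MatrixOrder Kronecker Ring

section FunctionalCalculus

variable {m n : Type*} [Fintype m] [DecidableEq m] [Fintype n] [DecidableEq n]

theorem aeval_mul_eq_mul_aeval {A : Matrix m m ℂ} {B : Matrix n n ℂ} {V : Matrix m n ℂ}
    (h : A * V = V * B) (p : Polynomial ℝ) : p.aeval A * V = V * p.aeval B := by
  induction p using Polynomial.induction_on with
  | C r => simp [Algebra.algebraMap_eq_smul_one]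
  | add p q hp hq => simp only [map_add, Matrix.add_mul, Matrix.mul_add, hp, hq]
  | monomial k r ih =>
    rw [pow_succ, ← mul_assoc, map_mul _ _ Polynomial.X, map_mul _ _ Polynomial.X,
      Polynomial.aeval_X, Polynomial.aeval_X, Matrix.mul_assoc, h,
      ← Matrix.mul_assoc, ih, Matrix.mul_assoc]

theorem cfc_mul_eq_mul_cfc {A : Matrix m m ℂ} {B : Matrix n n ℂ} (hA : A.IsHermitian)
    (hB : B.IsHermitian) {V : Matrix m n ℂ} (h : A * V = V * B) (f : ℝ → ℝ) :
    cfc f A * V = V * cfc f B := by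
  have hfin : (spectrum ℝ A ∪ spectrum ℝ B).Finite :=
    finite_real_spectrum.union finite_real_spectrum
  let p := Lagrange.interpolate hfin.toFinset id f
  have hp : Set.EqOn f p.eval (spectrum ℝ A ∪ spectrum ℝ B) := fun x hx =>
    (Lagrange.eval_interpolate_at_node f Function.injective_id.injOn (hfin.mem_toFinset.2 hx)).symm
  rw [cfc_congr (hp.mono Set.subset_union_left), cfc_polynomial p A hA.isSelfAdjoint,
    cfc_congr (hp.mono Set.subset_union_right), cfc_polynomial p B hB.isSelfAdjoint]
  exact aeval_mul_eq_mul_aeval h p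

theorem cfc_fromBlocks {A : Matrix m m ℂ} {B : Matrix n n ℂ} (hA : A.IsHermitian)
    (hB : B.IsHermitian) (f : ℝ → ℝ) :
    cfc f (fromBlocks A 0 0 B) = fromBlocks (cfc f A) 0 0 (cfc f B) := by
  have hAB : (fromBlocks A 0 0 B).IsHermitian := hA.fromBlocks (by simp) hB
  have hleft := cfc_mul_eq_mul_cfc hAB hA (V := fromRows 1 0)
    (by simp [fromBlocks_mul_fromRows, fromRows_mul]) f
  have hright := cfc_mul_eq_mul_cfc hAB hB (V := fromRows 0 1)
    (by simp [fromBlocks_mul_fromRows, fromRows_mul]) f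
  have hone : fromCols (fromRows 1 0) (fromRows 0 1) = (1 : Matrix (m ⊕ n) (m ⊕ n) ℂ) := by
    simp [fromCols_fromRows_eq_fromBlocks]
  rw [← Matrix.mul_one (cfc f _), ← hone, mul_fromCols, hleft, hright, fromRows_mul, fromRows_mul]
  simp [fromCols_fromRows_eq_fromBlocks]

theorem cfc_submatrix_equiv {A : Matrix n n ℂ} (hA : A.IsHermitian) (e : m ≃ n) (f : ℝ → ℝ) :
    cfc f (A.submatrix e e) = (cfc f A).submatrix e e := by
  let φ : Matrix n n ℂ ≃⋆ₐ[ℂ] Matrix m m ℂ := .ofAlgEquiv (reindexAlgEquiv ℂ ℂ e.symm) fun _ => rfl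
  have hφ : Continuous φ := Continuous.matrix_submatrix continuous_id e e
  exact (StarAlgHomClass.map_cfc φ f A (finite_real_spectrum.continuousOn f) hφ hA
    (hA.submatrix e)).symm

end FunctionalCalculus

section LoewnerOrder

variable {m n k : Type*}

theorem convex_setOf_posDef : Convex ℝ {D : Matrix n n ℂ | D.PosDef} :=
  convex_iff_forall_pos.2 fun _ hD _ hE _ _ hs ht _ =>
    (PosDef.smul hD hs).add (PosDef.smul hE ht)

section

variable [Finite m] [Finite n]

theorem posDef_fromBlocks {A : Matrix m m ℂ} {B : Matrix n n ℂ} (hA : A.PosDef)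
    (hB : B.PosDef) : (fromBlocks A 0 0 B).PosDef := by
  cases nonempty_fintype m
  cases nonempty_fintype n
  refine .of_dotProduct_mulVec_pos (hA.isHermitian.fromBlocks (by simp) hB.isHermitian)
    fun x hx => ?_
  obtain ⟨u, v, rfl⟩ : ∃ u v, x = Sum.elim u v := ⟨_, _, (Sum.elim_comp_inl_inr x).symm⟩
  have hsplit : star (Sum.elim u v) ⬝ᵥ fromBlocks A 0 0 B *ᵥ Sum.elim u v =
      star u ⬝ᵥ A *ᵥ u + star v ⬝ᵥ B *ᵥ v := by
    simp [fromBlocks_mulVec, Pi.star_def, ← Function.comp_def, Sum.comp_elim]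
  rw [hsplit]
  by_cases hu : u = 0
  · have hv : v ≠ 0 := by rintro rfl; simp [hu] at hx
    exact add_pos_of_nonneg_of_pos (hA.posSemidef.dotProduct_mulVec_nonneg u)
      (hB.dotProduct_mulVec_pos hv)
  · exact add_pos_of_pos_of_nonneg (hA.dotProduct_mulVec_pos hu)
      (hB.posSemidef.dotProduct_mulVec_nonneg v)

theorem exists_le_smul_one [DecidableEq m] {A : Matrix m m ℂ} (hA : A.IsHermitian) :
    ∃ a : ℝ, A ≤ a • 1 := by
  cases nonempty_fintype m
  obtain ⟨a, ha⟩ := A.finite_real_spectrum.bddAbove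
  refine ⟨a, ?_⟩
  rw [← Algebra.algebraMap_eq_smul_one]
  exact le_algebraMap_of_spectrum_le (fun x hx => ha hx) hA.isSelfAdjoint

theorem exists_pos_smul_one_le [DecidableEq m] {A : Matrix m m ℂ} (hA : A.PosDef) :
    ∃ a : ℝ, 0 < a ∧ a • 1 ≤ A := by
  cases nonempty_fintype m
  cases isEmpty_or_nonempty m
  · exact ⟨1, one_pos, (Subsingleton.elim _ _).le⟩
  · simpa only [Algebra.algebraMap_eq_smul_one] using
      (CFC.exists_pos_algebraMap_le_iff hA.isHermitian.isSelfAdjoint).2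
        fun x hx => hA.isStrictlyPositive.spectrum_pos hx

end

variable [Fintype m]

theorem conjTranspose_mul_mul_le [Finite n] {A B : Matrix m m ℂ} (h : A ≤ B) (V : Matrix m n ℂ) :
    Vᴴ * A * V ≤ Vᴴ * B * V := by
  simpa only [le_iff, Matrix.mul_sub, Matrix.sub_mul] using
    (le_iff.1 h).conjTranspose_mul_mul_same V

theorem re_dotProduct_mulVec_le {A B : Matrix m m ℂ} (h : A ≤ B) (v : m → ℂ) :
    (star v ⬝ᵥ A *ᵥ v).re ≤ (star v ⬝ᵥ B *ᵥ v).re := by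
  have hnonneg := (Complex.le_def.1 ((le_iff.1 h).dotProduct_mulVec_nonneg v)).1
  rwa [sub_mulVec, dotProduct_sub, Complex.sub_re, Complex.zero_re, sub_nonneg] at hnonneg

theorem conjTranspose_add_mul_mul_add_le [Finite n] {T : Matrix m m ℂ} (hT : T.PosSemidef)
    (A B : Matrix m n ℂ) {ε : ℝ} (hε : 0 < ε) :
    (A + B)ᴴ * T * (A + B) ≤ (1 + ε) • (Aᴴ * T * A) + (1 + ε⁻¹) • (Bᴴ * T * B) := by
  have hsq : (1 + ε) • (Aᴴ * T * A) + (1 + ε⁻¹) • (Bᴴ * T * B) - (A + B)ᴴ * T * (A + B) =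
      ε⁻¹ • ((ε • A - B)ᴴ * T * (ε • A - B)) := by
    simp only [conjTranspose_add, conjTranspose_sub, conjTranspose_smul, star_trivial,
      Matrix.add_mul, Matrix.mul_add, Matrix.sub_mul, Matrix.mul_sub, Matrix.smul_mul,
      Matrix.mul_smul]
    match_scalars <;> field_simp <;> ring
  rw [le_iff, hsq]
  exact (hT.conjTranspose_mul_mul_same _).smul (inv_nonneg.2 hε.le)

theorem conjTranspose_fromRows_mul_fromBlocks_mul_fromRows [Fintype k] (A : Matrix m m ℂ)
    (B : Matrix k k ℂ) (V : Matrix m n ℂ) (W : Matrix k n ℂ) :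
    (fromRows V W)ᴴ * fromBlocks A 0 0 B * fromRows V W = Vᴴ * A * V + Wᴴ * B * W := by
  rw [conjTranspose_fromRows_eq_fromCols_conjTranspose, fromCols_mul_fromBlocks,
    fromCols_mul_fromRows]
  simp only [Matrix.mul_zero, add_zero, zero_add]

end LoewnerOrder

section OperatorJensen

variable {m n k : Type*} [Fintype m] [DecidableEq m] [Fintype n] [DecidableEq n] [Fintype k]
  [DecidableEq k]

theorem IsMatrixMonotone.cfc_le_cfc {f : ℝ → ℝ} (hf : IsMatrixMonotone f) {A B : Matrix n n ℂ}
    (hA : A.PosDef) (hAB : A ≤ B) : cfc f A ≤ cfc f B := by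
  let e := (Fintype.equivFin n).symm
  have hB : B.PosDef := by simpa using hA.add_posSemidef (le_iff.1 hAB)
  have h := hf _ (A.submatrix e e) (B.submatrix e e) (hA.submatrix e.injective)
    (hB.submatrix e.injective) ((le_iff.1 hAB).submatrix e)
  rw [cfc_submatrix_equiv hA.isHermitian, cfc_submatrix_equiv hB.isHermitian] at h
  exact le_iff.2 ((posSemidef_submatrix_equiv e).1 h)

omit [DecidableEq m] in
-- `S` is block diagonal for the range of `V` and its complement; the slack `c > 1` in the first
-- block pays for the off-diagonal blocks of `T`.
theorem exists_le_and_mul_eq_mul_smul {V : Matrix m n ℂ} (hV : Vᴴ * V = 1) {T : Matrix m m ℂ}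
    (hT : T.PosSemidef) {c : ℝ} (hc : 1 < c) :
    ∃ S, T ≤ S ∧ S * V = V * (c • (Vᴴ * T * V)) := by
  classical
  obtain ⟨a, ha⟩ := exists_le_smul_one hT.isHermitian
  obtain ⟨P, hP⟩ : ∃ P, P = V * Vᴴ := ⟨_, rfl⟩
  have hPV : P * V = V := by rw [hP, Matrix.mul_assoc, hV, Matrix.mul_one]
  have hQV : (1 - P) * V = 0 := by rw [Matrix.sub_mul, Matrix.one_mul, hPV, sub_self]
  have hPh : Pᴴ = P := hP ▸ (isHermitian_mul_conjTranspose_self V).eq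
  have hPP : P * P = P := by nth_rw 2 [hP]; rw [← Matrix.mul_assoc, hPV, ← hP]
  have hQTQ : (1 - P)ᴴ * T * (1 - P) ≤ a • (1 - P) := by
    convert conjTranspose_mul_mul_le ha (1 - P) using 1
    simp [Matrix.mul_sub, Matrix.sub_mul, hPh, hPP]
  refine ⟨c • (Pᴴ * T * P) + (1 + (c - 1)⁻¹) • a • (1 - P), ?_, ?_⟩
  · have hc' := sub_pos.2 hc
    calc T = (P + (1 - P))ᴴ * T * (P + (1 - P)) := by simp
      _ ≤ (1 + (c - 1)) • (Pᴴ * T * P) + (1 + (c - 1)⁻¹) • ((1 - P)ᴴ * T * (1 - P)) :=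
        conjTranspose_add_mul_mul_add_le hT P (1 - P) hc'
      _ ≤ c • (Pᴴ * T * P) + (1 + (c - 1)⁻¹) • a • (1 - P) := by
        rw [add_sub_cancel]
        gcongr
  · calc (c • (Pᴴ * T * P) + (1 + (c - 1)⁻¹) • a • (1 - P)) * V = c • (P * T * V) := by
          simp only [Matrix.add_mul, Matrix.smul_mul, Matrix.mul_assoc, hQV, hPV, hPh, smul_zero,
            add_zero]
      _ = V * (c • (Vᴴ * T * V)) := by simp only [hP, Matrix.mul_smul, Matrix.mul_assoc]

theorem IsMatrixMonotone.conj_cfc_le_cfc_smul_conj {f : ℝ → ℝ} (hf : IsMatrixMonotone f)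
    {V : Matrix m n ℂ} (hV : Vᴴ * V = 1) {T : Matrix m m ℂ} (hT : T.PosDef) {c : ℝ} (hc : 1 < c) :
    Vᴴ * cfc f T * V ≤ cfc f (c • (Vᴴ * T * V)) := by
  obtain ⟨S, hTS, hSV⟩ := exists_le_and_mul_eq_mul_smul hV hT.posSemidef hc
  have hS : S.IsHermitian := by simpa using hT.isHermitian.add (le_iff.1 hTS).isHermitian
  have hX : (c • (Vᴴ * T * V)).IsHermitian :=
    (isHermitian_conjTranspose_mul_mul V hT.isHermitian).smul (.all c)
  calc Vᴴ * cfc f T * V ≤ Vᴴ * cfc f S * V := conjTranspose_mul_mul_le (hf.cfc_le_cfc hT hTS) V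
    _ = cfc f (c • (Vᴴ * T * V)) := by
      rw [Matrix.mul_assoc, cfc_mul_eq_mul_cfc hS hX hSV, ← Matrix.mul_assoc, hV, Matrix.one_mul]

theorem IsMatrixMonotone.smul_conj_cfc_add_smul_cfc_le {f : ℝ → ℝ} (hf : IsMatrixMonotone f)
    {V : Matrix m n ℂ} (hV : Vᴴ * V = 1) {T : Matrix m m ℂ} (hT : T.PosDef) {Z : Matrix n n ℂ}
    (hZ : Z.PosDef) {r c : ℝ} (hr₀ : 0 ≤ r) (hr₁ : r ≤ 1) (hc : 1 < c) :
    r • (Vᴴ * cfc f T * V) + (1 - r) • cfc f Z ≤ cfc f (c • (r • (Vᴴ * T * V) + (1 - r) • Z)) := by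
  let W : Matrix (m ⊕ n) n ℂ := fromRows (√r • V) (√(1 - r) • (1 : Matrix n n ℂ))
  have hcompress (A : Matrix m m ℂ) (B : Matrix n n ℂ) :
      Wᴴ * fromBlocks A 0 0 B * W = r • (Vᴴ * A * V) + (1 - r) • B := by
    rw [conjTranspose_fromRows_mul_fromBlocks_mul_fromRows]
    simp only [conjTranspose_smul, star_trivial, Matrix.smul_mul, Matrix.mul_smul, smul_smul,
      conjTranspose_one, Matrix.mul_one, Matrix.one_mul, Real.mul_self_sqrt hr₀,
      Real.mul_self_sqrt (sub_nonneg.2 hr₁)]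
  have hW : Wᴴ * W = 1 := by
    simpa only [fromBlocks_one, Matrix.mul_one, hV, ← add_smul, add_sub_cancel, one_smul]
      using hcompress 1 1
  simpa only [cfc_fromBlocks hT.isHermitian hZ.isHermitian, hcompress] using
    hf.conj_cfc_le_cfc_smul_conj hW (posDef_fromBlocks hT hZ) hc

-- Averaging `VᴴTV ≥ a` with the smaller scalar matrix `a / 2` makes room for the factor
-- `c = 2 / (1 + r) > 1`.
theorem IsMatrixMonotone.smul_conj_cfc_le_cfc_conj {f : ℝ → ℝ} (hf : IsMatrixMonotone f)
    (hnonneg : ∀ x, 0 < x → 0 ≤ f x) {V : Matrix m n ℂ} (hV : Vᴴ * V = 1) {T : Matrix m m ℂ}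
    (hT : T.PosDef) {r : ℝ} (hr₀ : 0 < r) (hr₁ : r < 1) :
    r • (Vᴴ * cfc f T * V) ≤ cfc f (Vᴴ * T * V) := by
  have hX : (Vᴴ * T * V).PosDef := hT.conjTranspose_mul_mul_same fun x y h => by
    simpa [hV] using congrArg (Vᴴ *ᵥ ·) h
  obtain ⟨a, ha, haX⟩ := exists_pos_smul_one_le hX
  obtain ⟨Z, hZa⟩ : ∃ Z : Matrix n n ℂ, Z = (a / 2) • 1 := ⟨_, rfl⟩
  have hZ : Z.PosDef := hZa ▸ PosDef.one.smul (half_pos ha)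
  have hZX : (2 : ℝ) • Z ≤ Vᴴ * T * V := by rwa [hZa, smul_smul, mul_div_cancel₀ a two_ne_zero]
  have hfZ : 0 ≤ cfc f Z :=
    cfc_nonneg fun x hx => hnonneg x (hZ.isStrictlyPositive.spectrum_pos hx)
  have hr : 0 < 1 - r := sub_pos.2 hr₁
  have hc : 1 < 2 / (1 + r) := (one_lt_div (by linarith)).2 (by linarith)
  calc r • (Vᴴ * cfc f T * V) ≤ r • (Vᴴ * cfc f T * V) + (1 - r) • cfc f Z :=
        le_add_of_nonneg_right (smul_nonneg hr.le hfZ)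
    _ ≤ cfc f ((2 / (1 + r)) • (r • (Vᴴ * T * V) + (1 - r) • Z)) :=
      hf.smul_conj_cfc_add_smul_cfc_le hV hT hZ hr₀.le hr₁.le hc
    _ ≤ cfc f (Vᴴ * T * V) := by
      refine hf.cfc_le_cfc (((hX.smul hr₀).add (hZ.smul hr)).smul (by positivity)) ?_
      rw [← sub_nonneg] at hZX ⊢
      have hdiff : Vᴴ * T * V - (2 / (1 + r)) • (r • (Vᴴ * T * V) + (1 - r) • Z) =
          ((1 - r) / (1 + r)) • (Vᴴ * T * V - (2 : ℝ) • Z) := by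
        match_scalars
        · field_simp
          ring
        · field_simp
      rw [hdiff]
      exact smul_nonneg (by positivity) hZX

open scoped Topology Matrix.Norms.L2Operator in
theorem IsMatrixMonotone.conj_cfc_le_cfc_conj {f : ℝ → ℝ} (hf : IsMatrixMonotone f)
    (hnonneg : ∀ x, 0 < x → 0 ≤ f x) {V : Matrix m n ℂ} (hV : Vᴴ * V = 1) {T : Matrix m m ℂ}
    (hT : T.PosDef) : Vᴴ * cfc f T * V ≤ cfc f (Vᴴ * T * V) := by
  have hlim : Filter.Tendsto (fun r : ℝ => r • (Vᴴ * cfc f T * V)) (𝓝[<] 1)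
      (𝓝 (Vᴴ * cfc f T * V)) := by
    have hid : Filter.Tendsto id (𝓝[<] (1 : ℝ)) (𝓝 1) := nhdsWithin_le_nhds
    simpa using hid.smul_const (Vᴴ * cfc f T * V)
  refine le_of_tendsto hlim ?_
  filter_upwards [Ioo_mem_nhdsLT zero_lt_one] with r hr
  exact hf.smul_conj_cfc_le_cfc_conj hnonneg hV hT hr.1 hr.2

theorem IsMatrixMonotone.conj_cfc_add_conj_cfc_le {f : ℝ → ℝ} (hf : IsMatrixMonotone f)
    (hnonneg : ∀ x, 0 < x → 0 ≤ f x) {V : Matrix m n ℂ} {W : Matrix k n ℂ}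
    (hVW : Vᴴ * V + Wᴴ * W = 1) {T : Matrix m m ℂ} {S : Matrix k k ℂ} (hT : T.PosDef)
    (hS : S.PosDef) :
    Vᴴ * cfc f T * V + Wᴴ * cfc f S * W ≤ cfc f (Vᴴ * T * V + Wᴴ * S * W) := by
  have hiso : (fromRows V W)ᴴ * fromRows V W = 1 := by
    rw [conjTranspose_fromRows_eq_fromCols_conjTranspose, fromCols_mul_fromRows, hVW]
  simpa only [cfc_fromBlocks hT.isHermitian hS.isHermitian,
    conjTranspose_fromRows_mul_fromBlocks_mul_fromRows] using
    hf.conj_cfc_le_cfc_conj hnonneg hiso (posDef_fromBlocks hT hS)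

end OperatorJensen

section OperatorPerspective

variable {n : Type*} [Fintype n] [DecidableEq n]

/-- The operator perspective `R^{1/2} f(R^{-1/2} L R^{-1/2}) R^{1/2}` of `f`, the noncommutative
version of `(x, y) ↦ y f(x / y)`; for commuting `L` and `R` it is `f(L R⁻¹) R`. -/
noncomputable def operatorPerspective (f : ℝ → ℝ) (L R : Matrix n n ℂ) : Matrix n n ℂ :=
  CFC.conjSqrt R (cfc f (CFC.conjSqrt R⁻¹ʳ L))

theorem conjSqrt_eq_mul_of_commute {S T : Matrix n n ℂ} (hS : S.PosSemidef) (h : Commute S T) :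
    CFC.conjSqrt S T = T * S := by
  have hsqrt : Commute (CFC.sqrt S) T := CFC.sqrt_eq_cfc (a := S) ▸ h.cfc_nnreal NNReal.sqrt
  rw [CFC.conjSqrt_apply, hsqrt.eq, mul_assoc, CFC.sqrt_mul_sqrt_self S hS.nonneg]

theorem operatorPerspective_of_commute (f : ℝ → ℝ) {L R : Matrix n n ℂ} (hR : R.PosDef)
    (h : Commute R L) : operatorPerspective f L R = cfc f (L * R⁻¹) * R := by
  have hinv : Commute R⁻¹ L := by
    simpa only [Matrix.zpow_neg_one] using Matrix.Commute.zpow_left h (-1)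
  have hLR : Commute (L * R⁻¹) R :=
    h.symm.mul_left (by simpa only [Matrix.zpow_neg_one] using Matrix.Commute.zpow_self R (-1))
  rw [operatorPerspective, ← nonsing_inv_eq_ringInverse,
    conjSqrt_eq_mul_of_commute hR.inv.posSemidef hinv,
    conjSqrt_eq_mul_of_commute hR.posSemidef (hLR.cfc_real f).symm]

theorem posDef_operatorPerspective {f : ℝ → ℝ} (hpos : ∀ x, 0 < x → 0 < f x) {L R : Matrix n n ℂ}
    (hL : L.PosDef) (hR : R.PosDef) : (operatorPerspective f L R).PosDef := by
  have hX : IsStrictlyPositive (CFC.conjSqrt R⁻¹ʳ L) :=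
    (CFC.isStrictlyPositive_conjSqrt_iff _ _ hR.isStrictlyPositive.ringInverse).2
      hL.isStrictlyPositive
  refine ((CFC.isStrictlyPositive_conjSqrt_iff R _ hR.isStrictlyPositive).2 ?_).posDef
  exact (cfc_isStrictlyPositive_iff f _ (finite_real_spectrum.continuousOn f)).2
    fun x hx => hpos x (hX.spectrum_pos hx)

theorem exists_conjTranspose_mul_mul_eq_smul_conjSqrt {s : ℝ} (hs : 0 ≤ s) (R S : Matrix n n ℂ) :
    ∃ V, ∀ X, Vᴴ * X * V = s • CFC.conjSqrt S (CFC.conjSqrt R X) := by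
  have hsqrt (T : Matrix n n ℂ) : (CFC.sqrt T)ᴴ = CFC.sqrt T :=
    (CFC.sqrt_nonneg T).isSelfAdjoint
  refine ⟨√s • (CFC.sqrt R * CFC.sqrt S), fun X => ?_⟩
  simp only [conjTranspose_smul, conjTranspose_mul, star_trivial, hsqrt, Matrix.smul_mul,
    Matrix.mul_smul, smul_smul, Real.mul_self_sqrt hs, CFC.conjSqrt_apply, Matrix.mul_assoc]

theorem IsMatrixMonotone.concaveOn_operatorPerspective {f : ℝ → ℝ} (hf : IsMatrixMonotone f)
    (hnonneg : ∀ x, 0 < x → 0 ≤ f x) :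
    ConcaveOn ℝ ({L : Matrix n n ℂ | L.PosDef} ×ˢ {R : Matrix n n ℂ | R.PosDef})
      fun p => operatorPerspective f p.1 p.2 := by
  refine ⟨convex_setOf_posDef.prod convex_setOf_posDef, ?_⟩
  rintro ⟨L₁, R₁⟩ ⟨hL₁, hR₁⟩ ⟨L₂, R₂⟩ ⟨hL₂, hR₂⟩ s t hs ht hst
  have hR := (convex_setOf_posDef hR₁ hR₂ hs ht hst).isStrictlyPositive
  replace hR₁ := PosDef.isStrictlyPositive hR₁
  replace hR₂ := PosDef.isStrictlyPositive hR₂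
  change s • operatorPerspective f L₁ R₁ + t • operatorPerspective f L₂ R₂ ≤
    operatorPerspective f (s • L₁ + t • L₂) (s • R₁ + t • R₂)
  set R := s • R₁ + t • R₂ with hRdef
  obtain ⟨V, hV⟩ := exists_conjTranspose_mul_mul_eq_smul_conjSqrt hs R₁ R⁻¹ʳ
  obtain ⟨W, hW⟩ := exists_conjTranspose_mul_mul_eq_smul_conjSqrt ht R₂ R⁻¹ʳ
  have hVW : Vᴴ * V + Wᴴ * W = 1 := by
    rw [← Matrix.mul_one Vᴴ, ← Matrix.mul_one Wᴴ, hV, hW, CFC.conjSqrt_one R₁ hR₁.nonneg,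
      CFC.conjSqrt_one R₂ hR₂.nonneg, ← map_smul, ← map_smul, ← map_add, ← hRdef,
      CFC.conjSqrt_ringInverse_self R hR]
  have hX₁ : IsStrictlyPositive (CFC.conjSqrt R₁⁻¹ʳ L₁) :=
    (CFC.isStrictlyPositive_conjSqrt_iff _ _ hR₁.ringInverse).2 (PosDef.isStrictlyPositive hL₁)
  have hX₂ : IsStrictlyPositive (CFC.conjSqrt R₂⁻¹ʳ L₂) :=
    (CFC.isStrictlyPositive_conjSqrt_iff _ _ hR₂.ringInverse).2 (PosDef.isStrictlyPositive hL₂)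
  have hjensen := hf.conj_cfc_add_conj_cfc_le hnonneg hVW hX₁.posDef hX₂.posDef
  rw [hV, hV, hW, hW, CFC.conjSqrt_conjSqrt_ringInverse R₁ L₁ hR₁,
    CFC.conjSqrt_conjSqrt_ringInverse R₂ L₂ hR₂] at hjensen
  simp only [← map_smul, ← map_add] at hjensen
  simpa only [CFC.conjSqrt_conjSqrt_ringInverse R _ hR, map_add, map_smul, operatorPerspective]
    using CFC.conjSqrt_le_conjSqrt (c := R) hjensen

end OperatorPerspective

section RingInverse

theorem ringInverse_map {M N F : Type*} [MonoidWithZero M] [MonoidWithZero N] [FunLike F M N]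
    [MonoidHomClass F M N] (φ : F) {a : M} (ha : IsUnit a) : (φ a)⁻¹ʳ = φ a⁻¹ʳ := by
  obtain ⟨u, rfl⟩ := ha
  rw [Ring.inverse_unit]
  exact Ring.inverse_unit (Units.map (φ : M →* N) u)

theorem convexOn_ringInverse_comp {E 𝓐 : Type*} [AddCommMonoid E] [SMul ℝ E] [CStarAlgebra 𝓐]
    [PartialOrder 𝓐] [StarOrderedRing 𝓐] {s : Set E} {g : E → 𝓐} (hg : ConcaveOn ℝ s g)
    (hpos : ∀ x ∈ s, IsStrictlyPositive (g x)) : ConvexOn ℝ s fun x => (g x)⁻¹ʳ := by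
  refine ⟨hg.1, fun x hx y hy a b ha hb hab => ?_⟩
  have hmem := CStarAlgebra.convexOn_ringInverse.1 (hpos x hx) (hpos y hy) ha hb hab
  calc (g (a • x + b • y))⁻¹ʳ ≤ (a • g x + b • g y)⁻¹ʳ :=
        CStarAlgebra.ringInverse_le_ringInverse (hg.2 hx hy ha hb hab) hmem
    _ ≤ a • (g x)⁻¹ʳ + b • (g y)⁻¹ʳ :=
      CStarAlgebra.convexOn_ringInverse.2 (hpos x hx) (hpos y hy) ha hb hab

open scoped Matrix.Norms.L2Operator in
theorem convexOn_re_dotProduct_inv_mulVec {E n : Type*} [AddCommMonoid E] [SMul ℝ E] [Fintype n]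
    [DecidableEq n] {s : Set E} {g : E → Matrix n n ℂ} (hg : ConcaveOn ℝ s g)
    (hpos : ∀ x ∈ s, (g x).PosDef) (v : n → ℂ) :
    ConvexOn ℝ s fun x => (star v ⬝ᵥ (g x)⁻¹ *ᵥ v).re := by
  have hinv := convexOn_ringInverse_comp hg fun x hx => (hpos x hx).isStrictlyPositive
  refine ⟨hg.1, fun x hx y hy a b ha hb hab => ?_⟩
  simpa only [nonsing_inv_eq_ringInverse, add_mulVec, dotProduct_add, smul_mulVec, dotProduct_smul,
    Complex.add_re, Complex.smul_re] using re_dotProduct_mulVec_le (hinv.2 hx hy ha hb hab) v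

end RingInverse

section MatrixUnits

theorem stdBasis_repr {R m n : Type*} [Fintype m] [Finite n] [Semiring R] (A : Matrix m n R) :
    ⇑((stdBasis R m n).repr A) = vec Aᵀ := by
  ext
  simp [stdBasis, vec]

variable {R n : Type*} [CommSemiring R] [Fintype n] [DecidableEq n]

theorem toMatrix_mulLeft_stdBasis (D : Matrix n n R) :
    (LinearMap.mulLeft R D).toMatrix (stdBasis R n n) (stdBasis R n n) = D ⊗ₖ 1 := by
  ext ⟨i, j⟩ ⟨k, l⟩
  by_cases h : j = l <;>
    simp [LinearMap.toMatrix_apply, stdBasis_repr, stdBasis_eq_single, vec, h]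

theorem toMatrix_mulRight_stdBasis (D : Matrix n n R) :
    (LinearMap.mulRight R D).toMatrix (stdBasis R n n) (stdBasis R n n) = 1 ⊗ₖ Dᵀ := by
  ext ⟨i, j⟩ ⟨k, l⟩
  by_cases h : i = k <;>
    simp [LinearMap.toMatrix_apply, stdBasis_repr, stdBasis_eq_single, vec, h]

theorem trace_conjTranspose_mul_toLin_stdBasis [Star R] (M : Matrix (n × n) (n × n) R)
    (A B : Matrix n n R) :
    (Aᴴ * M.toLin (stdBasis R n n) (stdBasis R n n) B).trace =
      star (vec Aᵀ) ⬝ᵥ M *ᵥ vec Bᵀ := by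
  rw [← stdBasis_repr B, ← repr_toLin (stdBasis R n n) (stdBasis R n n), stdBasis_repr,
    star_vec_dotProduct_vec, trace_mul_comm, ← trace_transpose, transpose_mul]
  rfl

end MatrixUnits

section MonotoneMetric

variable {n : Type*} [Fintype n] [DecidableEq n]

/-- The matrix of `jOp f D` in the basis of matrix units, in which `L_D` and `R_D` are represented
by `D ⊗ 1` and `1 ⊗ Dᵀ`. -/
noncomputable def jMatrix (f : ℝ → ℝ) (D : Matrix n n ℂ) : Matrix (n × n) (n × n) ℂ :=
  operatorPerspective f (D ⊗ₖ 1) (1 ⊗ₖ Dᵀ)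

theorem posDef_jMatrix {f : ℝ → ℝ} (hpos : ∀ x, 0 < x → 0 < f x) {D : Matrix n n ℂ}
    (hD : D.PosDef) : (jMatrix f D).PosDef :=
  posDef_operatorPerspective hpos (hD.kronecker .one) (PosDef.one.kronecker hD.transpose)

theorem IsMatrixMonotone.concaveOn_jMatrix {f : ℝ → ℝ} (hf : IsMatrixMonotone f)
    (hnonneg : ∀ x, 0 < x → 0 ≤ f x) :
    ConcaveOn ℝ {D : Matrix n n ℂ | D.PosDef} (jMatrix f) := by
  let φ : Matrix n n ℂ →ₗ[ℝ] Matrix (n × n) (n × n) ℂ × Matrix (n × n) (n × n) ℂ :=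
    { toFun := fun D => (D ⊗ₖ 1, 1 ⊗ₖ Dᵀ)
      map_add' := fun D E => by simp [add_kronecker, kronecker_add]
      map_smul' := fun r D => by simp [smul_kronecker, kronecker_smul] }
  exact ((hf.concaveOn_operatorPerspective hnonneg).comp_linearMap φ).subset
    (fun D hD => ⟨PosDef.kronecker hD .one, PosDef.one.kronecker (PosDef.transpose hD)⟩)
    convex_setOf_posDef

theorem jOp_eq_toLinAlgEquiv {n : ℕ} (f : ℝ → ℝ) {D : Matrix (Fin n) (Fin n) ℂ} (hD : D.PosDef) :
    jOp f D = toLinAlgEquiv (stdBasis ℂ (Fin n) (Fin n)) (jMatrix f D) := by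
  have hcomm : Commute (1 ⊗ₖ Dᵀ) (D ⊗ₖ (1 : Matrix (Fin n) (Fin n) ℂ)) := by
    simp [Commute, SemiconjBy, ← mul_kronecker_mul]
  rw [jMatrix, operatorPerspective_of_commute f (PosDef.one.kronecker hD.transpose) hcomm,
    inv_kronecker, inv_one, ← transpose_nonsing_inv, map_mul, ← toMatrix_mulLeft_stdBasis,
    ← toMatrix_mulRight_stdBasis, ← toMatrix_mulRight_stdBasis, ← LinearMap.toMatrix_mul]
  exact congrArg (superCfc f (modularOp D) * ·) (toLin_toMatrix _ _ _).symm

theorem isUnit_jOp {n : ℕ} {f : ℝ → ℝ} (hpos : ∀ x, 0 < x → 0 < f x)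
    {D : Matrix (Fin n) (Fin n) ℂ} (hD : D.PosDef) : IsUnit (jOp f D) := by
  rw [jOp_eq_toLinAlgEquiv f hD]
  exact (posDef_jMatrix hpos hD).isUnit.map _

theorem monotoneMetric_conjTranspose_self {n : ℕ} {f : ℝ → ℝ} (hpos : ∀ x, 0 < x → 0 < f x)
    {D : Matrix (Fin n) (Fin n) ℂ} (hD : D.PosDef) (A : Matrix (Fin n) (Fin n) ℂ) :
    monotoneMetric f D Aᴴ A = star (vec Aᵀ) ⬝ᵥ (jMatrix f D)⁻¹ *ᵥ vec Aᵀ := by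
  rw [monotoneMetric, jOp_eq_toLinAlgEquiv f hD, ringInverse_map _ (posDef_jMatrix hpos hD).isUnit,
    nonsing_inv_eq_ringInverse]
  exact trace_conjTranspose_mul_toLin_stdBasis _ A A

end MonotoneMetric

theorem mainTheorem5_general (f : ℝ → ℝ) (hpos : ∀ x, 0 < x → 0 < f x) (hf : IsMatrixMonotone f)
    (n : ℕ) (A : Matrix (Fin n) (Fin n) ℂ) :
    (∀ D : Matrix (Fin n) (Fin n) ℂ, D.PosDef →
      IsUnit (jOp f D) ∧ (monotoneMetric f D Aᴴ A).im = 0) ∧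
    ConvexOn ℝ {D : Matrix (Fin n) (Fin n) ℂ | D.PosDef}
      (fun D => (monotoneMetric f D Aᴴ A).re) := by
  refine ⟨fun D hD => ⟨isUnit_jOp hpos hD, ?_⟩, ?_⟩
  · have hinv : (jMatrix f D)⁻¹.PosSemidef := (posDef_jMatrix hpos hD).inv.posSemidef
    rw [monotoneMetric_conjTranspose_self hpos hD]
    exact (Complex.le_def.1 (hinv.dotProduct_mulVec_nonneg _)).2.symm
  · have hconcave := hf.concaveOn_jMatrix (n := Fin n) fun x hx => (hpos x hx).le
    refine (convexOn_re_dotProduct_inv_mulVec hconcave (fun D hD => posDef_jMatrix hpos hD)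
      (vec Aᵀ)).congr fun D hD => ?_
    rw [monotoneMetric_conjTranspose_self hpos hD]

theorem mainTheorem5 (f : ℝ → ℝ) (hf : IsStandardMatrixMonotone f) (n : ℕ)
    (A : Matrix (Fin n) (Fin n) ℂ) (hA : A.IsHermitian) :
    (∀ D : Matrix (Fin n) (Fin n) ℂ, D.PosDef →
      IsUnit (jOp f D) ∧ (monotoneMetric f D A A).im = 0) ∧
    ConvexOn ℝ {D : Matrix (Fin n) (Fin n) ℂ | D.PosDef}
      (fun D => (monotoneMetric f D A A).re) := by
  simpa only [hA.eq] using mainTheorem5_general f hf.pos hf.monotone n A
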